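/- **Setting.** Let $\diamondsuit$ be a cellular decomposition of a connected closed oriented surface into finitely many quadrilaterals, with vertices coloured black and white so that every edge joins a black vertex to a white one. A quadrilateral with vertices $x,y,x',y'$ in counterclockwise order is written $(x,y,x',y')$. The black vertices, joined by the black diagonals of the quadrilaterals, form a cellular decomposition $\Gamma$; the white ones form its dual $\Gamma^*$. Let $\Lambda=\Gamma\sqcup\Gamma^*$ be the double. Its edge set $\Lambda_1$ is the set of all diagonals, with duality of oriented edges $(x,x')^*=(y,y')$, $(y,y')^*=(x',x)$; the face $v^*$ dual to a vertex $v$ is bounded by the edges $e^*$ dual to the edges $e$ that start at $v$. Let $\rho>0$ be a function on unoriented edges of $\Lambda$ with $\rho(e^*)=1/\rho(e)$. Chains are real. Forms on $\Lambda$ (or on $\diamondsuit$) are complex cochains and $d$ is the coboundary. On $\Lambda$ the Hodge star is $\iint_{v^*}{*f}=f(v)$, $\int_e{*\alpha}=-\rho(e^*)\int_{e^*}\alpha$, $(*\omega)(v)=\iint_{v^*}\omega$ on forms of degree $0,1,2$, and a $1$-form is harmonic if $\Delta=-d{*}d{*}-{*}d{*}d$ vanishes on it. For $1$-forms on $\Lambda$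 put $$(\alpha,\beta)=\tfrac12\sum_{e\in\Lambda_1}\rho(e)\int_e\alpha\int_e\bar\beta,\qquad \iint_{(x,y,x',y')}\alpha\wedge\beta=\tfrac12\Bigl(\int_{(x,x')}\alpha\int_{(y,y')}\beta+\int_{(y,y')}\alpha\int_{(x',x)}\beta\Bigr).$$ For $1$-forms on $\diamondsuit$ put $$\iint_{(x_1,x_2,x_3,x_4)}\nu\wedge\nu'=\tfrac14\sum_{k=1}^4\Bigl(\int_{(x_{k-1},x_k)}\nu\int_{(x_k,x_{k+1})}\nu'-\int_{(x_{k+1},x_k)}\nu\int_{(x_k,x_{k-1})}\nu'\Bigr)$$ (indices mod $4$), and let $A\nu$ be the $1$-form on $\Lambda$ with $\int_{(x,x')}A\nu=\frac12\bigl(\int_{(x,y)}+\int_{(y,x')}+\int_{(x,y')}+\int_{(y',x')}\bigr)\nu$. Integrals $\iint_\diamondsuit$ are sums over all quadrilaterals. For a cycle $C\in Z_1(\Lambda)$ let $\eta_C$ be the harmonic $1$-form on $\Lambda$ whose period $\oint_B\eta_C$ along every cycle $B\in Z_1(\Lambda)$ is the algebraic number of times that $B$ contains an edge dual to an edge of $C$,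 namely $\sum_{e\in\Lambda_1}B(e)\,C(e^*)$. For $C\in Z_1(\diamondsuit)$ let $C_\Gamma\in Z_1(\Gamma)$ and $C_{\Gamma^*}\in Z_1(\Gamma^*)$ be cycles homologous to $C$ on the surface, and let $\eta_C$ be a closed $1$-form on $\diamondsuit$ with $A\eta_C=\eta_{C_\Gamma}+\eta_{C_{\Gamma^*}}$. The intersection number of two cycles of $\diamondsuit$ is $C\cdot C'=\iint_\diamondsuit\eta_C\wedge\eta_{C'}$. A canonical dissection $\aleph$ consists of a maximal tree $T$ of edges of $\diamondsuit$ and oriented edges $e_1,\dots,e_{2g}\notin T$ such that the cycles $\aleph_k\subset T\cup e_k$ running once through $e_k$ form a basis of $H_1(\diamondsuit)$ with $\aleph_k\cdot\aleph_\ell=\aleph_{k+g}\cdot\aleph_{\ell+g}=0$ and $\aleph_k\cdot\aleph_{\ell+g}=\delta_{k,\ell}$ for $1\le k,\ell\le g$. Let $\aleph^\Gamma_k$, $\aleph^{\Gamma^*}_k$ be cycles of $\Gamma$, $\Gamma^*$ homologous to $\aleph_k$ on the surface, and for $1\le k\le g$ put $$\aleph^\Lambda_k=\aleph^\Gamma_k,\quad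 \aleph^\Lambda_{k+g}=\aleph^{\Gamma^*}_k,\quad \aleph^\Lambda_{k+2g}=\aleph^{\Gamma^*}_{k+g},\quad \aleph^\Lambda_{k+3g}=\aleph^\Gamma_{k+g}.$$ For $1\le k\le 2g$ put $\alpha_k=\eta_{\aleph^\Lambda_{k+2g}}$ and $\alpha_{k+2g}=-\eta_{\aleph^\Lambda_k}$. **Proposition.** The $\alpha_k$ are real harmonic $1$-forms dual to $\aleph^\Lambda$, that is, $\oint_{\aleph^\Lambda_k}\alpha_\ell=\delta_{k,\ell}$ for $1\le k,\ell\le 4g$. The $4g\times4g$ matrix of inner products $$(\alpha_k,\alpha_\ell)=\iint_\diamondsuit\alpha_k\wedge{*\bar\alpha_\ell}=\begin{cases}+\frac12\oint_{\aleph^\Lambda_{k+2g}}{*\alpha_\ell},&1\le k\le 2g,\\[2pt]-\frac12\oint_{\aleph^\Lambda_{k-2g}}{*\alpha_\ell},&2g<k\le4g,\end{cases}$$ is real, symmetric and positive definite. -/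

import Mathlib

open scoped BigOperators ComplexConjugate

noncomputable section

/-- The oriented sides of the quadrilaterals: `(q, i)` is the `i`-th side, in counterclockwise order,
of the quadrilateral `q`.  Its origin is the `i`-th corner of `q`, its end is the `(i + 1)`-st one. -/
abbrev Side (Q : Type*) := Q × ZMod 4

namespace Side
variable {Q : Type*}

/-- The next side of the same quadrilateral. -/
def next (h : Side Q) : Side Q := (h.1, h.2 + 1)
/-- The opposite side of the same quadrilateral. -/
def opp (h : Side Q) : Side Q := (h.1, h.2 + 2)
/-- The previous side of the same quadrilateral. -/
def prev (h : Side Q) : Side Q := (h.1, h.2 + 3)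

theorem opp_next (h : Side Q) : next (opp h) = opp (next h) := by
  simp [next, opp, add_right_comm]
theorem opp_prev (h : Side Q) : prev (opp h) = opp (prev h) := by
  simp [prev, opp, add_right_comm]
theorem next_next (h : Side Q) : next (next h) = opp h := by
  simp only [next, opp, add_assoc]; rfl
theorem next_opp (h : Side Q) : next (opp h) = prev h := by
  simp only [next, opp, prev, add_assoc]; rfl
theorem opp_opp (h : Side Q) : opp (opp h) = h := by
  simp only [opp, add_assoc]
  have : (2 + 2 : ZMod 4) = 0 := rfl
  simp [this]
theorem prev_opp (h : Side Q) : prev (opp h) = next h := by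
  rw [← next_opp, opp_opp]

end Side

open Side

/-- A discrete compact Riemann surface, as a gluing of finitely many oriented quadrilaterals.
`twin` glues the sides in pairs, reversing their orientation; so the result is a closed oriented
surface with a cellular decomposition `◇` by quadrilaterals.  `black` is the bipartite colouring of
the vertices, recorded on the sides by the colour of their origin: the black vertices are those of
`Γ`, the white ones are those of `Γ*`.

The oriented edges of the double `Λ = Γ ⊔ Γ*` are the oriented diagonals of the quadrilaterals: the
diagonal which starts at the origin of the side `h` is also denoted by `h`.  It ends at the origin
of `opp h`, its reverse is `opp h`, and its oriented dual edge is `next h`: in a quadrilateral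
`(x, y, x', y')`, the dual of `(x, x')` is `(y, y')`, the dual of `(y, y')` is `(x', x)`.
`rho` is the discrete conformal structure. -/
structure DiscreteRiemannSurface (Q : Type*) where
  twin : Side Q → Side Q
  twin_twin : ∀ h, twin (twin h) = h
  twin_ne : ∀ h, twin h ≠ h
  nonempty : Nonempty Q
  connected : ∀ h h' : Side Q, Relation.EqvGen (fun a b => b = next a ∨ b = twin a) h h'
  black : Side Q → Bool
  black_next : ∀ h, black (next h) = !black h
  black_twin : ∀ h, black (twin h) = !black h
  rho : Side Q → ℝ
  rho_pos : ∀ h, 0 < rho h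
  rho_dual : ∀ h, rho (next h) = 1 / rho h

/-- Functions which change sign under `s`.  With `s` the reversal of oriented edges and `R = ℝ`
these are `1`-chains (`c e` is the coefficient of the oriented edge `e`); with `R = ℂ` they are
`1`-cochains, or `1`-forms (`α e` is the integral of `α` along `e`). -/
def oddFunctions {E : Type*} (s : E → E) (R : Type*) [CommRing R] : Submodule R (E → R) where
  carrier := {f | ∀ e, f (s e) = -f e}
  add_mem' := by
    intro a b ha hb e
    simp only [Set.mem_ofPred_eq] at ha hb
    simp [ha e, hb e, add_comm]
  zero_mem' := by intro e; simp
  smul_mem' := by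
    intro c a ha e
    simp only [Set.mem_ofPred_eq] at ha
    simp [ha e]

namespace DiscreteRiemannSurface

variable {Q : Type*} (S : DiscreteRiemannSurface Q)

/-- The vertices of `◇`, which are also those of `Λ`: sides with the same origin are identified.
Turning around the origin of `h`, one passes from `h` to `next (twin h)`. -/
def Vertex : Type _ := Quot (fun h h' : Side Q => h' = next (S.twin h))

/-- The origin of a side (and of the diagonal with the same name). -/
def org (h : Side Q) : S.Vertex := Quot.mk _ h

/-! ### Chains and forms on the double -/

/-- The real `1`-chains of `Λ`. -/
abbrev ChainL (_S : DiscreteRiemannSurface Q) : Type _ := oddFunctions (opp : Side Q → Side Q) ℝ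

/-- The complex `1`-forms of `Λ`. -/
abbrev FormL (_S : DiscreteRiemannSurface Q) : Type _ := oddFunctions (opp : Side Q → Side Q) ℂ

/-- The `1`-chain `c` of `Λ` lives on `Γ`. -/
def OnGamma (c : S.ChainL) : Prop := ∀ h, S.black h = false → c.1 h = 0

/-- The `1`-chain `c` of `Λ` lives on `Γ*`. -/
def OnGammaStar (c : S.ChainL) : Prop := ∀ h, S.black h = true → c.1 h = 0

/-- The Hodge star on `1`-forms: `∫_e *α = -ρ(e*) ∫_{e*} α`. -/
def hodge (α : S.FormL) : S.FormL :=
  ⟨fun h => -(S.rho (next h) : ℂ) * α.1 (next h), fun h => by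
    have h1 : S.rho (next (opp h)) = S.rho (next h) := by
      have e : next (opp h) = next (next (next h)) := by rw [next_next, opp_next]
      rw [e, S.rho_dual (next (next h)), S.rho_dual (next h), one_div_one_div]
    have h2 : α.1 (next (opp h)) = -α.1 (next h) := by rw [opp_next]; exact α.2 _
    simp only [h1, h2]; ring⟩

/-- Complex conjugation of `1`-forms. -/
def conjForm (α : S.FormL) : S.FormL :=
  ⟨fun h => conj (α.1 h), fun h => by
    have h2 : α.1 (opp h) = -α.1 h := α.2 h
    simp only [h2, map_neg]⟩

/-- The coboundary of a function on the vertices. -/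
def d0 (f : S.Vertex → ℂ) : S.FormL :=
  ⟨fun h => f (S.org (opp h)) - f (S.org h), fun h => by simp only [opp_opp]; ring⟩

variable [Fintype Q]

open Classical in
/-- The `1`-cycles of `Λ`: at each vertex, the coefficients of the outgoing edges add up to zero. -/
def IsCycleL (c : S.ChainL) : Prop :=
  ∀ v, ∑ h ∈ Finset.univ.filter (fun h => S.org h = v), c.1 h = 0

/-- The integral of a `1`-form along a `1`-chain of `Λ`; every edge occurs in the sum with its two
orientations. -/
def integral (c : S.ChainL) (α : S.FormL) : ℂ := (1 / 2) * ∑ h, (c.1 h : ℂ) * α.1 h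

open Classical in
/-- The coboundary of a `1`-form.  A `2`-form `ω` of `Λ` is encoded by `v ↦ ∬_{v*} ω`, where the face
`v*` dual to `v` is bounded by the diagonals dual to those that start at `v`.  With this encoding
the Hodge star between functions and `2`-forms, `∬_{v*} *f = f v` and `(*ω) v = ∬_{v*} ω`, is the
identity. -/
def d1 (α : S.FormL) : S.Vertex → ℂ :=
  fun v => ∑ h ∈ Finset.univ.filter (fun h => S.org h = v), α.1 (next h)

/-- The Laplacian `Δ = -d * d * - * d * d` on `1`-forms. -/
def laplacian (α : S.FormL) : S.FormL :=
  -S.d0 (S.d1 (S.hodge α)) - S.hodge (S.d0 (S.d1 α))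

/-- Harmonic `1`-forms. -/
def IsHarmonic (α : S.FormL) : Prop := S.laplacian α = 0

/-- The weighted hermitian scalar product `½ ∑_{e ∈ Λ₁} ρ(e) (∫_e α) (∫_e β̄)` on `1`-forms of `Λ`; the two
unoriented edges in the quadrilateral `q` are the diagonals `(q, 0)` and `(q, 1)`. -/
def scalar (α β : S.FormL) : ℂ :=
  (1 / 2) * ∑ q : Q, ((S.rho (q, 0) : ℂ) * α.1 (q, 0) * conj (β.1 (q, 0)) +
    (S.rho (q, 1) : ℂ) * α.1 (q, 1) * conj (β.1 (q, 1)))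

/-- The integral over the surface of the wedge product of two `1`-forms of `Λ`, where
`∬_{(x, y, x', y')} α ∧ β = ½ (∫_{(x, x')} α ∫_{(y, y')} β + ∫_{(y, y')} α ∫_{(x', x)} β)`. -/
def wedge (α β : S.FormL) : ℂ :=
  ∑ q : Q, (1 / 2) * (α.1 (q, 0) * β.1 (q, 1) + α.1 (q, 1) * β.1 (q, 2))

/-- The algebraic number of times that `a` contains an edge dual to an edge of `c`, which is
`∑_{e ∈ Λ₁} a(e) c(e*)`. -/
def crossing (a c : S.ChainL) : ℝ := (1 / 2) * ∑ h, a.1 h * c.1 (next h)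

/-- `η` is a harmonic form whose period along each cycle `a` is the algebraic number of times that `a`
contains an edge dual to an edge of `c`. -/
def IsEta (c : S.ChainL) (η : S.FormL) : Prop :=
  S.IsHarmonic η ∧ ∀ a : S.ChainL, S.IsCycleL a → S.integral a η = (S.crossing a c : ℂ)

/-- The harmonic form `η_c` of a cycle `c` of `Λ`. -/
def eta (c : S.ChainL) : S.FormL := Classical.epsilon (S.IsEta c)

/-! ### Chains and forms on the quad-graph -/

/-- The real `1`-chains of `◇`. -/
abbrev ChainD (S : DiscreteRiemannSurface Q) : Type _ := oddFunctions S.twin ℝ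

/-- The complex `1`-forms of `◇`. -/
abbrev FormD (S : DiscreteRiemannSurface Q) : Type _ := oddFunctions S.twin ℂ

open Classical in
/-- The space `Z₁(◇)` of `1`-cycles: at each vertex, the coefficients of the outgoing edges add up to
zero. -/
def cyclesD : Submodule ℝ S.ChainD where
  carrier := {c | ∀ v, ∑ h ∈ Finset.univ.filter (fun h => S.org h = v), c.1 h = 0}
  add_mem' := by
    intro a b ha hb v
    simp only [Set.mem_ofPred_eq] at ha hb
    simp [Finset.sum_add_distrib, ha v, hb v]
  zero_mem' := by intro v; simp
  smul_mem' := by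
    intro r a ha v
    simp only [Set.mem_ofPred_eq] at ha
    simp [← Finset.mul_sum, ha v]

/-- The boundary of a `2`-chain `s` of `◇`; the boundary of the quadrilateral `q` is the sum of the
four sides `(q, i)`. -/
def boundaryD (s : Q → ℝ) : S.ChainD :=
  ⟨fun h => s h.1 - s (S.twin h).1, fun h => by simp only [S.twin_twin]; ring⟩

/-- The space `B₁(◇)` of boundaries. -/
def boundariesD : Submodule ℝ S.ChainD where
  carrier := Set.range S.boundaryD
  add_mem' := by
    rintro _ _ ⟨s, rfl⟩ ⟨t, rfl⟩
    refine ⟨s + t, Subtype.ext (funext fun h => ?_)⟩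
    simp only [boundaryD, Pi.add_apply, Submodule.coe_add]; ring
  zero_mem' := ⟨0, Subtype.ext (funext fun h => by simp [boundaryD])⟩
  smul_mem' := by
    rintro r _ ⟨s, rfl⟩
    refine ⟨r • s, Subtype.ext (funext fun h => ?_)⟩
    simp only [boundaryD, Pi.smul_apply, Submodule.coe_smul, smul_eq_mul]; ring

/-- The classes of the cycles `c k` form a basis of the homology group `H₁(◇) = Z₁(◇) / B₁(◇)`: they
are linearly independent modulo boundaries, and they generate all cycles modulo boundaries. -/
def IsHomologyBasis {ι : Type*} [Fintype ι] (c : ι → S.ChainD) : Prop :=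
  (∀ k, c k ∈ S.cyclesD) ∧
  (∀ x : ι → ℝ, ∑ k, x k • c k ∈ S.boundariesD → x = 0) ∧
  (∀ z ∈ S.cyclesD, ∃ x : ι → ℝ, z - ∑ k, x k • c k ∈ S.boundariesD)

/-- A chain of `Λ` viewed on `◇`: each diagonal `(x, x')` of a quadrilateral `(x, y, x', y')` is replaced
by the mean of the two paths `(x, y, x')` and `(x, y', x')` along its sides, which are homologous to
it on the surface. -/
def toDiam (c : S.ChainL) : S.ChainD :=
  ⟨fun h => (1 / 2) * (c.1 h + c.1 (prev h) - c.1 (S.twin h) - c.1 (prev (S.twin h))),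
    fun h => by simp only [S.twin_twin]; ring⟩

/-- The cycle `a` of `Λ` is homologous, on the surface, to the cycle `c` of `◇`. -/
def IsHomologous (a : S.ChainL) (c : S.ChainD) : Prop :=
  S.IsCycleL a ∧ S.toDiam a - c ∈ S.boundariesD

/-- `a` is a cycle `c_Γ` of `Γ` homologous to `c` on the surface. -/
def IsGammaPart (c : S.ChainD) (a : S.ChainL) : Prop := S.OnGamma a ∧ S.IsHomologous a c

/-- `a` is a cycle `c_{Γ*}` of `Γ*` homologous to `c` on the surface. -/
def IsGammaStarPart (c : S.ChainD) (a : S.ChainL) : Prop := S.OnGammaStar a ∧ S.IsHomologous a c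

/-- Closed `1`-forms on `◇`. -/
def IsClosedD (ν : S.FormD) : Prop := ∀ q, ∑ i : ZMod 4, ν.1 (q, i) = 0

/-- The averaging map from `1`-forms of `◇` to `1`-forms of `Λ`: in a quadrilateral `(x, y, x', y')`, its
value on `(x, x')` is `½ (∫_{(x, y)} + ∫_{(y, x')} + ∫_{(x, y')} + ∫_{(y', x')}) ν`. -/
def average (ν : S.FormD) : S.FormL :=
  ⟨fun h => (1 / 2) * (ν.1 h + ν.1 (next h) - ν.1 (prev h) - ν.1 (opp h)), fun h => by
    simp only [opp_opp, next_opp, prev_opp]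
    ring⟩

/-- The integral over the surface of the wedge product of two `1`-forms of `◇`, where
`∬_{(x₁, x₂, x₃, x₄)} ν ∧ ν'` is a quarter of the sum over `k` of
`∫_{(x_{k-1}, x_k)} ν ∫_{(x_k, x_{k+1})} ν' - ∫_{(x_{k+1}, x_k)} ν ∫_{(x_k, x_{k-1})} ν'`. -/
def wedgeD (ν ν' : S.FormD) : ℂ :=
  ∑ q : Q, (1 / 4) * ∑ k : ZMod 4,
    (ν.1 (q, k - 1) * ν'.1 (q, k) - (-ν.1 (q, k)) * (-ν'.1 (q, k - 1)))

/-- `ν` is a closed form `η_c` on `◇` attached to the cycle `c` of `◇`: its average on `Λ` is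
`η_{c_Γ} + η_{c_{Γ*}}`. -/
def IsEtaD (c : S.ChainD) (ν : S.FormD) : Prop :=
  S.IsClosedD ν ∧ ∃ a b : S.ChainL, S.IsGammaPart c a ∧ S.IsGammaStarPart c b ∧
    S.average ν = S.eta a + S.eta b

/-- The intersection number `c · c' = ∬ η_c ∧ η_{c'}` of two cycles of `◇` is `z`. -/
def HasIntersection (c c' : S.ChainD) (z : ℂ) : Prop :=
  ∃ ν ν' : S.FormD, S.IsEtaD c ν ∧ S.IsEtaD c' ν' ∧ S.wedgeD ν ν' = z

/-- A canonical dissection of a surface of genus `g`.  The index `inl k` stands for `k`, and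
`inr k` for `k + g`, where `1 ≤ k ≤ g`.  The cycle `cyc k` is the one which the oriented edge
`edge k` forms with the maximal tree `tree`. -/
structure CanonicalDissection (g : ℕ) where
  tree : Set (Side Q)
  tree_twin : ∀ h ∈ tree, S.twin h ∈ tree
  tree_acyclic : ∀ c ∈ S.cyclesD, (∀ h, h ∉ tree → c.1 h = 0) → c = 0
  tree_maximal : ∀ e, e ∉ tree →
    ∃ c ∈ S.cyclesD, c ≠ 0 ∧ ∀ h, h ∉ tree → h ≠ e → h ≠ S.twin e → c.1 h = 0
  edge : Fin g ⊕ Fin g → Side Q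
  edge_notMem : ∀ k, edge k ∉ tree
  cyc : Fin g ⊕ Fin g → S.ChainD
  cyc_edge : ∀ k, (cyc k).1 (edge k) = 1
  cyc_support : ∀ k h, h ∉ tree → h ≠ edge k → h ≠ S.twin (edge k) → (cyc k).1 h = 0
  isHomologyBasis : S.IsHomologyBasis cyc
  inter_left : ∀ k l, S.HasIntersection (cyc (.inl k)) (cyc (.inl l)) 0
  inter_right : ∀ k l, S.HasIntersection (cyc (.inr k)) (cyc (.inr l)) 0
  inter : ∀ k l, S.HasIntersection (cyc (.inl k)) (cyc (.inr l)) (if k = l then 1 else 0)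

/-- The `4g` indices of the basis `ℵ^Λ`: for `1 ≤ k ≤ g`, the indices `k`, `k + g`, `k + 2g`, `k + 3g` are
`inl (inl k)`, `inl (inr k)`, `inr (inl k)`, `inr (inr k)`; so the indices `j ≤ 2g` are the
`inl j`, and `j + 2g` is then `inr j`. -/
abbrev Index (g : ℕ) := (Fin g ⊕ Fin g) ⊕ (Fin g ⊕ Fin g)

/-- The cycles `ℵ^Λ`, composed of the cycles `a k` of `Γ` and the cycles `b k` of `Γ*`. -/
def alephL {S : DiscreteRiemannSurface Q} {g : ℕ} (a b : Fin g ⊕ Fin g → S.ChainL) :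
    Index g → S.ChainL
  | .inl (.inl k) => a (.inl k)
  | .inl (.inr k) => b (.inl k)
  | .inr (.inl k) => b (.inr k)
  | .inr (.inr k) => a (.inr k)

/-- The harmonic forms `α`: for `1 ≤ j ≤ 2g`, `α_j = η_{ℵ_{j + 2g}}` and `α_{j + 2g} = -η_{ℵ_j}`. -/
def alpha {S : DiscreteRiemannSurface Q} {g : ℕ} (aleph : Index g → S.ChainL) : Index g → S.FormL
  | .inl j => S.eta (aleph (.inr j))
  | .inr j => -S.eta (aleph (.inl j))

end DiscreteRiemannSurface
end

/-! Everything rests on a discrete Poincaré duality. Since dualising an oriented edge twice reverses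
it, the form `dualForm c`, namely `e ↦ c(e*)`, is closed when `c` is a cycle, and its periods are
the crossing numbers with `c`. Orthogonal projection makes it coclosed by adding an exact form
(`exists_coclosed_add_d0`), and a coclosed form is determined by its periods
(`eq_zero_of_integral_eq_zero`). Hence `η_c = dualForm c + df`, and wedging it with a closed form
`β` gives `½ ∮_c β` (`wedge_eta_left`). The period formulas follow from `(α, β) = ∬ α ∧ *β̄`,
because `*α_l` is closed.

Duality of `α` and `ℵ^Λ` concerns crossing numbers. Two cycles of the same colour never cross. For
cycles of `◇`, averaging preserves wedge products of closed forms, so `c · c'` is the mean of the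
two mixed crossing numbers, `Γ` with `Γ*` and `Γ*` with `Γ`. These are equal, since the average of a
closed form has the same period along both representatives of `c'`. They do not depend on the
representatives, since a bounding cycle of one graph has zero crossing with every cycle of the other
(`crossing_eq_zero_of_mem_boundariesD`).

Finally the `α_k` are linearly independent by duality, so their Gram matrix for a positive diagonal
weight is positive definite. -/

section

open Side

/-! ### Rotation of the sides of a quadrilateral. -/

namespace Side
variable {Q : Type*}

theorem next_prev (h : Side Q) : next (prev h) = h := by
  rw [← next_opp, next_next, opp_opp]
theorem prev_next (h : Side Q) : prev (next h) = h := by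
  rw [← next_opp, ← opp_next, next_next, opp_opp]

/-- Passing to the next side, as a permutation. -/
def nextEquiv : Side Q ≃ Side Q := ⟨next, prev, prev_next, next_prev⟩
/-- Passing to the opposite side, as a permutation. -/
def oppEquiv : Side Q ≃ Side Q := ⟨opp, opp, opp_opp, opp_opp⟩

variable [Fintype Q] {M : Type*} [AddCommMonoid M]

theorem sum_next (F : Side Q → M) : ∑ h, F (next h) = ∑ h, F h := nextEquiv.sum_comp F
theorem sum_opp (F : Side Q → M) : ∑ h, F (opp h) = ∑ h, F h := oppEquiv.sum_comp F

theorem sum_eq_sum_quad (F : Side Q → M) :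
    ∑ h, F h = ∑ q, (F (q, 0) + F (q, 1) + F (q, 2) + F (q, 3)) := by
  rw [Fintype.sum_prod_type]
  exact Finset.sum_congr rfl fun q _ => Fin.sum_univ_four (fun i : Fin 4 => F (q, i))

end Side

/-! ### Pointwise formulas for chains and forms. -/

namespace DiscreteRiemannSurface
variable {Q : Type*} (S : DiscreteRiemannSurface Q)

theorem org_next_twin (h : Side Q) : S.org (next (S.twin h)) = S.org h :=
  (Quot.sound (r := fun h h' : Side Q => h' = next (S.twin h)) rfl).symm
theorem org_next (h : Side Q) : S.org (next h) = S.org (S.twin h) := by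
  rw [← S.org_next_twin (S.twin h), S.twin_twin]

theorem rho_opp (h : Side Q) : S.rho (opp h) = S.rho h := by
  rw [← next_next, S.rho_dual, S.rho_dual, one_div_one_div]

theorem black_opp (h : Side Q) : S.black (opp h) = S.black h := by
  rw [← next_next, S.black_next, S.black_next, Bool.not_not]
theorem black_prev (h : Side Q) : S.black (prev h) = !S.black h := by
  rw [← next_opp, S.black_next, black_opp]

/-- The gluing of the sides, as a permutation. -/
def twinEquiv : Side Q ≃ Side Q := ⟨S.twin, S.twin, S.twin_twin, S.twin_twin⟩

@[simp] theorem formL_opp (α : S.FormL) (h : Side Q) : α.1 (opp h) = -α.1 h := α.2 h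
@[simp] theorem chainL_opp (c : S.ChainL) (h : Side Q) : c.1 (opp h) = -c.1 h := c.2 h
theorem formD_twin (α : S.FormD) (h : Side Q) : α.1 (S.twin h) = -α.1 h := α.2 h

theorem hodge_apply (α : S.FormL) (h : Side Q) :
    (S.hodge α).1 h = -(S.rho (next h) : ℂ) * α.1 (next h) := rfl
theorem conjForm_apply (α : S.FormL) (h : Side Q) : (S.conjForm α).1 h = conj (α.1 h) := rfl
theorem d0_apply (f : S.Vertex → ℂ) (h : Side Q) :
    (S.d0 f).1 h = f (S.org (opp h)) - f (S.org h) := rfl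

theorem hodge_next (α : S.FormL) (h : Side Q) : (S.hodge α).1 (next h) = S.rho h * α.1 h := by
  rw [hodge_apply, next_next, rho_opp, formL_opp]; ring

/-- The form `e ↦ c(e*)`, which counts the crossings with the chain `c`. -/
def dualForm (c : S.ChainL) : S.FormL :=
  ⟨fun h => (c.1 (next h) : ℂ), fun h => by
    simp only [opp_next, chainL_opp, Complex.ofReal_neg]⟩

theorem dualForm_apply (c : S.ChainL) (h : Side Q) : (S.dualForm c).1 h = c.1 (next h) := rfl

theorem formD_opp {ν : S.FormD} (hν : S.IsClosedD ν) (h : Side Q) :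
    ν.1 (opp h) = -ν.1 h - ν.1 (next h) - ν.1 (prev h) := by
  have h1 : ∀ q, ν.1 (q, 0) + ν.1 (q, 1) + ν.1 (q, 2) + ν.1 (q, 3) = 0 := fun q =>
    (Fin.sum_univ_four (fun i : Fin 4 => ν.1 (q, i))).symm.trans (hν q)
  obtain ⟨q, i⟩ := h
  have h2 := h1 q
  have : i = 0 ∨ i = 1 ∨ i = 2 ∨ i = 3 := by revert i; decide
  rcases this with rfl | rfl | rfl | rfl
  · change ν.1 (q, 2) = -ν.1 (q, 0) - ν.1 (q, 1) - ν.1 (q, 3); linear_combination h2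
  · change ν.1 (q, 3) = -ν.1 (q, 1) - ν.1 (q, 2) - ν.1 (q, 0); linear_combination h2
  · change ν.1 (q, 0) = -ν.1 (q, 2) - ν.1 (q, 3) - ν.1 (q, 1); linear_combination h2
  · change ν.1 (q, 1) = -ν.1 (q, 3) - ν.1 (q, 0) - ν.1 (q, 2); linear_combination h2

/-- For a closed form the two paths along the sides have the same integral, so their mean is either
one. -/
theorem average_apply {ν : S.FormD} (hν : S.IsClosedD ν) (h : Side Q) :
    (S.average ν).1 h = ν.1 h + ν.1 (next h) := by
  change 1 / 2 * (ν.1 h + ν.1 (next h) - ν.1 (prev h) - ν.1 (opp h)) = _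
  rw [S.formD_opp hν]; ring

theorem toDiam_apply (c : S.ChainL) (h : Side Q) : (S.toDiam c).1 h =
    (1 / 2) * (c.1 h + c.1 (prev h) - c.1 (S.twin h) - c.1 (prev (S.twin h))) := rfl

theorem boundaryD_apply (s : Q → ℝ) (h : Side Q) :
    (S.boundaryD s).1 h = s h.1 - s (S.twin h).1 := rfl

theorem toDiam_sub (a b : S.ChainL) : S.toDiam (a - b) = S.toDiam a - S.toDiam b :=
  Subtype.ext (funext fun h => by
    simp only [toDiam_apply, Submodule.coe_sub, Pi.sub_apply]; ring)

theorem conjForm_neg (α : S.FormL) : S.conjForm (-α) = -S.conjForm α :=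
  Subtype.ext (funext fun h => by simp [conjForm_apply])

variable [Fintype Q]

/-! ### Summation by parts, wedge products and periods. -/

theorem sum_twin {M : Type*} [AddCommMonoid M] (F : Side Q → M) :
    ∑ h, F (S.twin h) = ∑ h, F h := S.twinEquiv.sum_comp F

open Classical in
theorem sum_org_mul_eq_zero {R : Type*} [CommRing R] (x : Side Q → R)
    (hx : ∀ v, ∑ h ∈ Finset.univ.filter (fun h => S.org h = v), x h = 0) (f : S.Vertex → R) :
    ∑ h, f (S.org h) * x h = 0 := by
  rw [← Finset.sum_fiberwise_of_maps_to (s := Finset.univ) (t := Finset.univ.image S.org)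
    (g := S.org) (fun h _ => Finset.mem_image_of_mem _ (Finset.mem_univ h))]
  refine Finset.sum_eq_zero fun v _ => ?_
  have : ∑ h ∈ Finset.univ.filter (fun h => S.org h = v), f (S.org h) * x h
      = ∑ h ∈ Finset.univ.filter (fun h => S.org h = v), f v * x h :=
    Finset.sum_congr rfl fun h hh => by rw [(Finset.mem_filter.1 hh).2]
  rw [this, ← Finset.mul_sum, hx v, mul_zero]

open Classical in
theorem sum_fiber_eq_sum {R : Type*} [CommRing R] (x : Side Q → R) (v : S.Vertex) :
    ∑ h ∈ Finset.univ.filter (fun h => S.org h = v), x h =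
      ∑ h, (if S.org h = v then 1 else 0) * x h := by
  simp [Finset.sum_filter]

theorem sum_d0_mul (f : S.Vertex → ℂ) (x : Side Q → ℂ) (hx : ∀ h, x (opp h) = -x h) :
    ∑ h, (S.d0 f).1 h * x h = -2 * ∑ h, f (S.org h) * x h := by
  have h1 : ∑ h, f (S.org (opp h)) * x h = -∑ h, f (S.org h) * x h := by
    rw [← sum_opp (fun h => f (S.org h) * x h), ← Finset.sum_neg_distrib]
    exact Finset.sum_congr rfl fun h _ => by rw [hx]; ring
  simp only [d0_apply, sub_mul, Finset.sum_sub_distrib, h1]; ring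

theorem sum_d0_mul_next (f : S.Vertex → ℂ) {β : S.FormL} (hβ : S.d1 β = 0) :
    ∑ h, (S.d0 f).1 h * β.1 (next h) = 0 := by
  rw [S.sum_d0_mul f (fun h => β.1 (next h)) (fun h => by rw [opp_next, formL_opp]),
    S.sum_org_mul_eq_zero (fun h => β.1 (next h)) (fun v => congrFun hβ v), mul_zero]

/-- Turning around a vertex, the edges dual to the outgoing diagonals form a closed polygon, so the
differences of `f` telescope. -/
theorem d1_d0 (f : S.Vertex → ℂ) : S.d1 (S.d0 f) = 0 := by
  classical
  funext v
  have key : ∀ u : S.Vertex → ℂ, ∑ h, u (S.org h) * f (S.org (prev h)) =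
      ∑ h, u (S.org h) * f (S.org (next h)) := by
    intro u
    rw [← sum_next, ← S.sum_twin]
    -- The turn `h ↦ next (twin h)` keeps the origin and carries the end of one dual edge to the
    -- start of its neighbour.
    exact Finset.sum_congr rfl fun h _ => by rw [org_next_twin, prev_next, ← org_next]
  simp only [d1]
  rw [sum_fiber_eq_sum]
  simp only [d0_apply, ← opp_next, next_opp, mul_sub, Finset.sum_sub_distrib]
  rw [key (fun w => if w = v then 1 else 0), sub_self]; rfl

/-- The product `α(h) β(h*)` is unchanged by `opp`, so summing over all four sides counts each
diagonal twice; hence `¼` instead of `½`. -/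
theorem wedge_eq (α β : S.FormL) : S.wedge α β = (1 / 4) * ∑ h, α.1 h * β.1 (next h) := by
  rw [sum_eq_sum_quad, wedge, Finset.mul_sum]
  refine Finset.sum_congr rfl fun q _ => ?_
  have a2 : α.1 (q, 2) = -α.1 (q, 0) := S.formL_opp α (q, 0)
  have a3 : α.1 (q, 3) = -α.1 (q, 1) := S.formL_opp α (q, 1)
  have b2 : β.1 (q, 2) = -β.1 (q, 0) := S.formL_opp β (q, 0)
  have b3 : β.1 (q, 3) = -β.1 (q, 1) := S.formL_opp β (q, 1)
  have e0 : next ((q, 0) : Side Q) = (q, 1) := rfl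
  have e1 : next ((q, 1) : Side Q) = (q, 2) := rfl
  have e2 : next ((q, 2) : Side Q) = (q, 3) := rfl
  have e3 : next ((q, 3) : Side Q) = (q, 0) := rfl
  rw [e0, e1, e2, e3, a2, a3, b2, b3]; ring

theorem scalar_eq (α β : S.FormL) :
    S.scalar α β = (1 / 4) * ∑ h, (S.rho h : ℂ) * α.1 h * conj (β.1 h) := by
  rw [sum_eq_sum_quad, scalar, Finset.mul_sum, Finset.mul_sum]
  refine Finset.sum_congr rfl fun q _ => ?_
  have a2 : α.1 (q, 2) = -α.1 (q, 0) := S.formL_opp α (q, 0)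
  have a3 : α.1 (q, 3) = -α.1 (q, 1) := S.formL_opp α (q, 1)
  have b2 : β.1 (q, 2) = -β.1 (q, 0) := S.formL_opp β (q, 0)
  have b3 : β.1 (q, 3) = -β.1 (q, 1) := S.formL_opp β (q, 1)
  have r2 : S.rho (q, 2) = S.rho (q, 0) := S.rho_opp (q, 0)
  have r3 : S.rho (q, 3) = S.rho (q, 1) := S.rho_opp (q, 1)
  rw [r2, r3, a2, a3, b2, b3, map_neg, map_neg]; ring

theorem wedge_hodge_conjForm (α β : S.FormL) :
    S.scalar α β = S.wedge α (S.hodge (S.conjForm β)) := by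
  rw [scalar_eq, wedge_eq]
  congr 1
  exact Finset.sum_congr rfl fun h _ => by rw [hodge_next, conjForm_apply]; ring

theorem wedge_add_left (α α' β : S.FormL) :
    S.wedge (α + α') β = S.wedge α β + S.wedge α' β := by
  simp only [wedge_eq, Submodule.coe_add, Pi.add_apply, add_mul, Finset.sum_add_distrib, mul_add]

theorem wedge_add_right (α β β' : S.FormL) :
    S.wedge α (β + β') = S.wedge α β + S.wedge α β' := by
  simp only [wedge_eq, Submodule.coe_add, Pi.add_apply, Finset.sum_add_distrib, mul_add]

theorem wedge_d0_left (f : S.Vertex → ℂ) {β : S.FormL} (hβ : S.d1 β = 0) :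
    S.wedge (S.d0 f) β = 0 := by
  rw [wedge_eq, S.sum_d0_mul_next f hβ, mul_zero]

theorem integral_add (c : S.ChainL) (α β : S.FormL) :
    S.integral c (α + β) = S.integral c α + S.integral c β := by
  simp only [integral, Submodule.coe_add, Pi.add_apply, Finset.sum_add_distrib, mul_add]

theorem integral_neg (c : S.ChainL) (α : S.FormL) :
    S.integral c (-α) = -S.integral c α := by
  simp only [integral, Submodule.coe_neg, Pi.neg_apply, Finset.sum_neg_distrib, mul_neg]

theorem integral_d0 {c : S.ChainL} (hc : S.IsCycleL c) (f : S.Vertex → ℂ) :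
    S.integral c (S.d0 f) = 0 := by
  have h1 := S.sum_d0_mul f (fun h => (c.1 h : ℂ)) (fun h => by simp)
  have h2 := S.sum_org_mul_eq_zero (fun h => (c.1 h : ℂ))
    (fun v => by exact_mod_cast congrArg (fun r : ℝ => (r : ℂ)) (hc v)) f
  rw [h2, mul_zero] at h1
  rw [integral, ← mul_zero (1 / 2 : ℂ), ← h1]
  simp only [mul_comm]

theorem crossing_swap (a c : S.ChainL) : S.crossing a c = -S.crossing c a := by
  rw [crossing, crossing, ← sum_next, ← mul_neg, ← Finset.sum_neg_distrib]
  congr 1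
  exact Finset.sum_congr rfl fun h _ => by rw [next_next, chainL_opp]; ring

theorem crossing_sub_left (a a' c : S.ChainL) :
    S.crossing (a - a') c = S.crossing a c - S.crossing a' c := by
  simp only [crossing, Submodule.coe_sub, Pi.sub_apply, sub_mul, Finset.sum_sub_distrib, mul_sub]

/-! ### Harmonic forms -/

theorem d1_hodge_apply (α : S.FormL) (v : S.Vertex) :
    S.d1 (S.hodge α) v =
      open Classical in ∑ h ∈ Finset.univ.filter (fun h => S.org h = v), S.rho h * α.1 h := by
  simp only [d1, hodge_next]

/-- With `ω = dβ` constant along diagonals, summation by parts turns `∑ |ω(v)|²` into a pairing of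
`β` with `dω̄ = 0`. Connectedness is not needed. -/
theorem d1_eq_zero_of_d0_eq_zero {β : S.FormL} (h : S.d0 (S.d1 β) = 0) : S.d1 β = 0 := by
  classical
  have hc : ∀ h', conj (S.d1 β (S.org (opp h'))) = conj (S.d1 β (S.org h')) := fun h' => by
    have : (S.d0 (S.d1 β)).1 h' = 0 := by rw [h]; rfl
    rw [sub_eq_zero.1 this]
  have h0 : ∑ h', conj (S.d1 β (S.org h')) * β.1 (next h') = 0 := by
    have := S.sum_d0_mul (fun v => conj (S.d1 β v)) (fun h => β.1 (next h))
      (fun h => by rw [opp_next, formL_opp])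
    simp only [d0_apply, hc, sub_self, zero_mul, Finset.sum_const_zero] at this
    simpa using this.symm
  have h1 : ∑ v ∈ Finset.univ.image S.org, conj (S.d1 β v) * S.d1 β v = 0 := by
    rw [← h0, ← Finset.sum_fiberwise_of_maps_to (s := Finset.univ) (t := Finset.univ.image S.org)
      (g := S.org) (fun h _ => Finset.mem_image_of_mem _ (Finset.mem_univ h))]
    refine Finset.sum_congr rfl fun v _ => ?_
    conv_lhs => rw [d1, Finset.mul_sum]
    refine Finset.sum_congr (by congr) fun h hh => ?_
    rw [(Finset.mem_filter.1 hh).2]; rfl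
  have h2 : ∑ v ∈ Finset.univ.image S.org, Complex.normSq (S.d1 β v) = 0 := by
    have : ((∑ v ∈ Finset.univ.image S.org, Complex.normSq (S.d1 β v) : ℝ) : ℂ) = 0 := by
      rw [← h1]; push_cast
      exact Finset.sum_congr rfl fun v _ => Complex.normSq_eq_conj_mul_self
    exact_mod_cast this
  funext v
  obtain ⟨h', rfl⟩ := Quot.exists_rep v
  exact Complex.normSq_eq_zero.1 ((Finset.sum_eq_zero_iff_of_nonneg
    fun v _ => Complex.normSq_nonneg _).1 h2 _ (Finset.mem_image_of_mem S.org (Finset.mem_univ h')))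

theorem eq_zero_of_sum_rho_mul_conj {β : Side Q → ℂ}
    (h : ∑ h, (S.rho h : ℂ) * β h * conj (β h) = 0) : β = 0 := by
  have h2 : ∑ h, S.rho h * Complex.normSq (β h) = 0 := by
    have : ((∑ h, S.rho h * Complex.normSq (β h) : ℝ) : ℂ) = 0 := by
      rw [← h]; push_cast
      exact Finset.sum_congr rfl fun v _ => by rw [mul_assoc, Complex.mul_conj]
    exact_mod_cast this
  funext v
  have := (Finset.sum_eq_zero_iff_of_nonneg fun v _ =>
    mul_nonneg (S.rho_pos v).le (Complex.normSq_nonneg _)).1 h2 v (Finset.mem_univ v)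
  exact Complex.normSq_eq_zero.1 ((mul_eq_zero.1 this).resolve_left (S.rho_pos v).ne')

/-- Vanishing of `Δη` makes one exact form the Hodge star of another, up to sign. Exact forms are
orthogonal to Hodge stars of exact forms, so both vanish. -/
theorem IsHarmonic.closed_and_coclosed {S : DiscreteRiemannSurface Q} {η : S.FormL}
    (h : S.IsHarmonic η) : S.d1 η = 0 ∧ S.d1 (S.hodge η) = 0 := by
  have h1 : ∀ x, (S.d0 (S.d1 (S.hodge η))).1 x = S.rho (next x) * (S.d0 (S.d1 η)).1 (next x) := by
    intro x
    have : (S.laplacian η).1 x = 0 := by rw [show S.laplacian η = 0 from h]; rfl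
    simp only [laplacian, Submodule.coe_sub, Submodule.coe_neg, Pi.sub_apply, Pi.neg_apply,
      hodge_apply] at this
    linear_combination -this
  have h2 : (S.d0 (S.d1 η)).1 = 0 := by
    apply S.eq_zero_of_sum_rho_mul_conj
    rw [← sum_next, ← S.sum_d0_mul_next (S.d1 (S.hodge η)) (S.d1_d0 (fun v => conj (S.d1 η v)))]
    refine Finset.sum_congr rfl fun x _ => ?_
    rw [h1, d0_apply, d0_apply, map_sub]
  refine ⟨S.d1_eq_zero_of_d0_eq_zero (Subtype.ext h2), S.d1_eq_zero_of_d0_eq_zero ?_⟩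
  refine Subtype.ext (funext fun x => ?_)
  rw [h1, h2]; simp

theorem isHarmonic_of_closed_of_coclosed {η : S.FormL} (h : S.d1 η = 0)
    (h' : S.d1 (S.hodge η) = 0) : S.IsHarmonic η := by
  have hz : S.d0 0 = 0 := Subtype.ext (funext fun x => by simp [d0_apply])
  rw [IsHarmonic, laplacian, h, h', hz]
  exact Subtype.ext (funext fun x => by simp [hodge_apply])

/-- A coclosed form with vanishing periods is zero. -/
theorem eq_zero_of_integral_eq_zero {η : S.FormL} (h : S.d1 (S.hodge η) = 0)
    (hp : ∀ a : S.ChainL, S.IsCycleL a → S.integral a η = 0) : η = 0 := by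
  classical
  have hv : ∀ v, ∑ h ∈ Finset.univ.filter (fun h => S.org h = v), S.rho h * η.1 h = 0 :=
    fun v => by rw [← d1_hodge_apply, h]; rfl
  -- Coclosedness of `η` says that `ρη` satisfies the cycle condition. Its real and imaginary parts
  -- are thus admissible cycles, and the periods of `η` along them combine to `∑ ρ|η|²`.
  let a : S.ChainL := ⟨fun x => S.rho x * (η.1 x).re, fun x => by simp [rho_opp]⟩
  let b : S.ChainL := ⟨fun x => S.rho x * (η.1 x).im, fun x => by simp [rho_opp]⟩
  have ha : S.IsCycleL a := fun v => by
    have := congrArg Complex.re (hv v)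
    simp only [Complex.re_sum, Complex.re_ofReal_mul, Complex.zero_re] at this
    convert this
  have hb : S.IsCycleL b := fun v => by
    have := congrArg Complex.im (hv v)
    simp only [Complex.im_sum, Complex.im_ofReal_mul, Complex.zero_im] at this
    convert this
  have h1 := hp a ha
  have h2 := hp b hb
  rw [integral, mul_eq_zero, or_iff_right (by norm_num)] at h1 h2
  refine Subtype.ext (S.eq_zero_of_sum_rho_mul_conj ?_)
  have : ∀ x, (S.rho x : ℂ) * η.1 x * conj (η.1 x) =
      (a.1 x : ℂ) * η.1 x - Complex.I * ((b.1 x : ℂ) * η.1 x) := fun x => by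
    have e : conj (η.1 x) = (η.1 x).re - Complex.I * (η.1 x).im := by
      apply Complex.ext <;> simp
    rw [e]; simp only [a, b]; push_cast; ring
  simp only [this, Finset.sum_sub_distrib, ← Finset.mul_sum, h1, h2, mul_zero, sub_zero]

/-! ### The harmonic forms of cycles. -/

theorem d1_dualForm {c : S.ChainL} (hc : S.IsCycleL c) : S.d1 (S.dualForm c) = 0 := by
  funext v
  have := hc v
  simp only [d1, dualForm_apply, next_next, chainL_opp, Pi.zero_apply]
  rw [← Complex.ofReal_sum, Finset.sum_neg_distrib, this]; simp

theorem d1_add (α β : S.FormL) : S.d1 (α + β) = S.d1 α + S.d1 β := by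
  funext v
  simp [d1, Finset.sum_add_distrib]

theorem integral_dualForm (a c : S.ChainL) : S.integral a (S.dualForm c) = S.crossing a c := by
  simp [integral, crossing, dualForm_apply]

theorem wedge_dualForm (c : S.ChainL) (β : S.FormL) :
    S.wedge (S.dualForm c) β = (1 / 2) * S.integral c β := by
  rw [wedge_eq, integral, ← sum_next (fun h => (c.1 h : ℂ) * β.1 h), ← mul_assoc]
  norm_num [dualForm_apply]

/-- Each form is, up to an exact one, coclosed. -/
theorem exists_coclosed_add_d0 (θ : S.FormL) : ∃ f, S.d1 (S.hodge (θ + S.d0 f)) = 0 := by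
  classical
  -- Scaling by `√ρ` turns the `ρ`-weighted product into the standard one, in which the exact forms
  -- are the range of `T`.
  let w : Side Q → ℂ := fun h => (Real.sqrt (S.rho h) : ℂ)
  have hw : ∀ h, w h * w h = S.rho h := fun h => by
    simp only [w]; rw [← Complex.ofReal_mul, Real.mul_self_sqrt (S.rho_pos h).le]
  have hwc : ∀ h, conj (w h) = w h := fun h => Complex.conj_ofReal _
  let T : (S.Vertex → ℂ) →ₗ[ℂ] EuclideanSpace ℂ (Side Q) :=
    { toFun := fun f => WithLp.toLp 2 fun h => w h * (S.d0 f).1 h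
      map_add' := fun f g => by
        ext h; simp [d0_apply]; ring
      map_smul' := fun r f => by
        ext h; simp [d0_apply]; ring }
  let x : EuclideanSpace ℂ (Side Q) := WithLp.toLp 2 fun h => w h * θ.1 h
  obtain ⟨f, hf⟩ : (T.range.starProjection x) ∈ T.range := Submodule.starProjection_apply_mem _ _
  have ho : x - T.range.starProjection x ∈ T.rangeᗮ := Submodule.sub_starProjection_mem_orthogonal _
  rw [← hf] at ho
  have hop : ∀ g : S.Vertex → ℂ, ∑ h, conj ((S.d0 g).1 h) * (S.rho h * (θ + S.d0 (-f)).1 h) = 0 := by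
    intro g
    have := (Submodule.mem_orthogonal _ _).1 ho (T g) ⟨g, rfl⟩
    rw [PiLp.inner_apply] at this
    rw [← this]
    refine Finset.sum_congr rfl fun h _ => ?_
    simp only [T, x, LinearMap.coe_mk, AddHom.coe_mk, RCLike.inner_apply, PiLp.sub_apply, map_mul,
      hwc, ← hw, Submodule.coe_add, Pi.add_apply, d0_apply, Pi.neg_apply, map_sub]
    ring
  refine ⟨-f, funext fun v => ?_⟩
  -- Orthogonality to the coboundary of the indicator of `v` is coclosedness at `v`.
  have h1 := hop (fun u => if u = v then 1 else 0)
  have h2 : ∀ h, conj ((S.d0 fun u => if u = v then 1 else 0).1 h) =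
      (S.d0 fun u => if u = v then 1 else 0).1 h := fun h => by
    simp only [d0_apply, map_sub]; split_ifs <;> simp
  simp only [h2] at h1
  rw [sum_d0_mul _ _ _ (fun h => by rw [rho_opp, formL_opp]; ring), mul_eq_zero,
    or_iff_right (by norm_num)] at h1
  refine (S.d1_hodge_apply _ v).trans ?_
  rw [sum_fiber_eq_sum]
  exact h1

theorem IsEta.unique {S : DiscreteRiemannSurface Q} {c : S.ChainL} {η η' : S.FormL}
    (h : S.IsEta c η) (h' : S.IsEta c η') : η = η' := by
  rw [← sub_eq_zero]
  apply S.eq_zero_of_integral_eq_zero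
  · have h1 := h.1.closed_and_coclosed.2
    have h2 := h'.1.closed_and_coclosed.2
    have e : S.hodge η = S.hodge (η - η') + S.hodge η' :=
      Subtype.ext (funext fun x => by simp [hodge_apply]; ring)
    rw [e, d1_add, h2, add_zero] at h1
    exact h1
  · intro a ha
    rw [sub_eq_add_neg, integral_add, integral_neg, h.2 a ha, h'.2 a ha, add_neg_cancel]

theorem exists_isEta {c : S.ChainL} (hc : S.IsCycleL c) :
    ∃ f, S.IsEta c (S.dualForm c + S.d0 f) := by
  obtain ⟨f, hf⟩ := S.exists_coclosed_add_d0 (S.dualForm c)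
  refine ⟨f, S.isHarmonic_of_closed_of_coclosed ?_ hf, fun a ha => ?_⟩
  · rw [d1_add, S.d1_dualForm hc, d1_d0, add_zero]
  · rw [integral_add, S.integral_d0 ha, integral_dualForm, add_zero]

theorem isEta_eta {c : S.ChainL} (hc : S.IsCycleL c) : S.IsEta c (S.eta c) :=
  by
  obtain ⟨f, hf⟩ := S.exists_isEta hc
  exact Classical.epsilon_spec (p := S.IsEta c) ⟨_, hf⟩

theorem exists_eta_eq {c : S.ChainL} (hc : S.IsCycleL c) :
    ∃ f, S.eta c = S.dualForm c + S.d0 f := by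
  obtain ⟨f, hf⟩ := S.exists_isEta hc
  exact ⟨f, (S.isEta_eta hc).unique hf⟩

/-- The exact part of `η_c` pairs to zero with a closed form; `dualForm c` contributes the period,
with the factor `½` built into the wedge product. -/
theorem wedge_eta_left {c : S.ChainL} (hc : S.IsCycleL c) {β : S.FormL} (hβ : S.d1 β = 0) :
    S.wedge (S.eta c) β = (1 / 2) * S.integral c β := by
  obtain ⟨f, hf⟩ := S.exists_eta_eq hc
  rw [hf, wedge_add_left, wedge_dualForm, S.wedge_d0_left f hβ, add_zero]

/-- Crossing numbers are real, so the conjugate is harmonic with the same periods, and uniqueness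
applies. -/
theorem conjForm_eta {c : S.ChainL} (hc : S.IsCycleL c) : S.conjForm (S.eta c) = S.eta c := by
  have he := S.isEta_eta hc
  obtain ⟨h1, h2⟩ := he.1.closed_and_coclosed
  refine IsEta.unique ⟨S.isHarmonic_of_closed_of_coclosed ?_ ?_, fun a ha => ?_⟩ he
  · funext v
    have := congrArg conj (congrFun h1 v)
    simpa [d1, conjForm_apply] using this
  · funext v
    have := congrArg conj (congrFun h2 v)
    simpa [d1_hodge_apply, conjForm_apply] using this
  · have := congrArg conj (he.2 a ha)
    have h2 : conj (2 : ℂ) = 2 := Complex.conj_ofNat 2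
    simpa [integral, conjForm_apply, h2] using this

/-! ### Intersection numbers -/

/-- Closedness expresses the fourth side through the other three; what remains is a polynomial
identity in each quadrilateral. -/
theorem wedgeD_eq_wedge_average {ν ν' : S.FormD} (hν : S.IsClosedD ν) (hν' : S.IsClosedD ν') :
    S.wedgeD ν ν' = S.wedge (S.average ν) (S.average ν') := by
  rw [wedgeD, wedge]
  refine Finset.sum_congr rfl fun q _ => ?_
  simp only [S.average_apply hν, S.average_apply hν']
  have e : ∀ F : ZMod 4 → ℂ, ∑ k, F k = F 0 + F 1 + F 2 + F 3 := fun F =>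
    Fin.sum_univ_four (fun i : Fin 4 => F i)
  have h3 : ν.1 (q, 3) = -ν.1 (q, 0) - ν.1 (q, 1) - ν.1 (q, 2) := by
    have := (e _).symm.trans (hν q); linear_combination this
  have h3' : ν'.1 (q, 3) = -ν'.1 (q, 0) - ν'.1 (q, 1) - ν'.1 (q, 2) := by
    have := (e _).symm.trans (hν' q); linear_combination this
  rw [e]
  change 1 / 4 * ((ν.1 (q, 3) * ν'.1 (q, 0) - (-ν.1 (q, 0)) * (-ν'.1 (q, 3))) +
    (ν.1 (q, 0) * ν'.1 (q, 1) - (-ν.1 (q, 1)) * (-ν'.1 (q, 0))) +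
    (ν.1 (q, 1) * ν'.1 (q, 2) - (-ν.1 (q, 2)) * (-ν'.1 (q, 1))) +
    (ν.1 (q, 2) * ν'.1 (q, 3) - (-ν.1 (q, 3)) * (-ν'.1 (q, 2)))) =
    1 / 2 * ((ν.1 (q, 0) + ν.1 (q, 1)) * (ν'.1 (q, 1) + ν'.1 (q, 2)) +
      (ν.1 (q, 1) + ν.1 (q, 2)) * (ν'.1 (q, 2) + ν'.1 (q, 3)))
  rw [h3, h3']; ring

/-- A form on `◇` is integrated over a cycle of `Λ` by means of its average. -/
theorem integral_average (a : S.ChainL) {ν : S.FormD} (hν : S.IsClosedD ν) :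
    S.integral a (S.average ν) = (1 / 2) * ∑ h, ((S.toDiam a).1 h : ℂ) * ν.1 h := by
  have h1 : ∑ h, (a.1 h : ℂ) * ν.1 (next h) = ∑ h, (a.1 (prev h) : ℂ) * ν.1 h := by
    rw [← sum_next fun h => (a.1 (prev h) : ℂ) * ν.1 h]
    simp only [prev_next]
  have h2 : ∑ h, (a.1 (S.twin h) : ℂ) * ν.1 h = -∑ h, (a.1 h : ℂ) * ν.1 h := by
    rw [← S.sum_twin fun h => (a.1 h : ℂ) * ν.1 h, ← Finset.sum_neg_distrib]
    exact Finset.sum_congr rfl fun h _ => by rw [formD_twin]; ring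
  have h3 : ∑ h, (a.1 (prev (S.twin h)) : ℂ) * ν.1 h = -∑ h, (a.1 (prev h) : ℂ) * ν.1 h := by
    rw [← S.sum_twin fun h => (a.1 (prev h) : ℂ) * ν.1 h, ← Finset.sum_neg_distrib]
    exact Finset.sum_congr rfl fun h _ => by rw [formD_twin]; ring
  have h4 : ∀ h, ((S.toDiam a).1 h : ℂ) * ν.1 h = (1 / 2) * ((a.1 h : ℂ) * ν.1 h +
      (a.1 (prev h) : ℂ) * ν.1 h - (a.1 (S.twin h) : ℂ) * ν.1 h -
      (a.1 (prev (S.twin h)) : ℂ) * ν.1 h) := fun h => by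
    rw [toDiam_apply]; push_cast; ring
  simp only [integral, S.average_apply hν, h4, mul_add, ← Finset.mul_sum, Finset.sum_add_distrib,
    Finset.sum_sub_distrib, h1, h2, h3]
  ring

theorem sum_mul_eq_zero_of_mem_boundariesD {c : S.ChainD} (hc : c ∈ S.boundariesD) {ν : S.FormD}
    (hν : S.IsClosedD ν) : ∑ h, (c.1 h : ℂ) * ν.1 h = 0 := by
  obtain ⟨s, rfl⟩ := hc
  have h1 : ∑ h : Side Q, (s h.1 : ℂ) * ν.1 h = 0 := by
    rw [Fintype.sum_prod_type]
    exact Finset.sum_eq_zero fun q _ => by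
      rw [← mul_zero (s q : ℂ), ← hν q, Finset.mul_sum]
  have h2 : ∑ h : Side Q, (s (S.twin h).1 : ℂ) * ν.1 h = -∑ h : Side Q, (s h.1 : ℂ) * ν.1 h := by
    rw [← S.sum_twin fun h => (s h.1 : ℂ) * ν.1 h, ← Finset.sum_neg_distrib]
    exact Finset.sum_congr rfl fun h _ => by rw [formD_twin]; ring
  simp only [boundaryD_apply, Complex.ofReal_sub, sub_mul, Finset.sum_sub_distrib, h2, h1]
  simp

theorem integral_average_congr {a b : S.ChainL} {c : S.ChainD} (ha : S.IsHomologous a c)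
    (hb : S.IsHomologous b c) {ν : S.FormD} (hν : S.IsClosedD ν) :
    S.integral a (S.average ν) = S.integral b (S.average ν) := by
  have h := S.sum_mul_eq_zero_of_mem_boundariesD (S.boundariesD.sub_mem ha.2 hb.2) hν
  have e : ∀ x, ((S.toDiam a - c - (S.toDiam b - c)).1 x : ℂ) * ν.1 x =
      (S.toDiam a).1 x * ν.1 x - (S.toDiam b).1 x * ν.1 x := fun x => by
    simp only [Submodule.coe_sub, Pi.sub_apply]; push_cast; ring
  simp only [e, Finset.sum_sub_distrib, sub_eq_zero] at h
  rw [S.integral_average a hν, S.integral_average b hν, h]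

/-- A cycle on one of the graphs `Γ`, `Γ*` which bounds on the surface crosses each cycle on the
other graph algebraically zero times. -/
theorem crossing_eq_zero_of_mem_boundariesD (col : Bool) {a b : S.ChainL}
    (ha : ∀ h, S.black h = !col → a.1 h = 0) (hb : ∀ h, S.black h = col → b.1 h = 0)
    (hbc : S.IsCycleL b) (h0 : S.toDiam a ∈ S.boundariesD) : S.crossing a b = 0 := by
  obtain ⟨s, hs⟩ := h0
  -- The diagonal carrying `a` cuts each quadrilateral into two triangles, one for each corner of
  -- the other colour. `G` corrects `-s` by `±½ a` on these triangles. It is constant around each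
  -- such corner, so it descends to a function `F` on vertices whose increment across an edge of `a`
  -- is the coefficient of `a`. The crossing number is then, up to sign, the integral of `dF` along
  -- the cycle `b`.
  let G : Side Q → ℝ := fun k => if S.black k = col then 0 else (1 / 2) * a.1 (prev k) - s k.1
  have hG : ∀ k, G k = G (next (S.twin k)) := by
    intro k
    have hk : S.black (next (S.twin k)) = S.black k := by simp [S.black_next, S.black_twin]
    simp only [G, hk, prev_next]
    split_ifs with h
    · rfl
    · have h1 := congrFun (congrArg Subtype.val hs) (S.twin k)
      have h2 : a.1 k = 0 := ha k (by revert h; cases S.black k <;> cases col <;> simp)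
      have h3 : a.1 (prev (S.twin k)) = 0 := ha _ (by
        rw [black_prev, S.black_twin, Bool.not_not]
        revert h; cases S.black k <;> cases col <;> simp)
      rw [toDiam_apply, boundaryD_apply, S.twin_twin, h2, h3] at h1
      have h4 : (next (S.twin k)).1 = (S.twin k).1 := rfl
      rw [h4]
      linarith
  let F : S.Vertex → ℝ := Quot.lift G fun x y hxy => by rw [hxy]; exact hG x
  have hF : ∀ h, F (S.org h) = G h := fun h => rfl
  have h1 : ∀ h, a.1 h * b.1 (next h) = (G (next h) - G (opp (next h))) * b.1 (next h) := by
    intro h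
    by_cases hc : S.black h = col
    · have e1 : S.black (next h) = !col := by rw [S.black_next, hc]
      have e2 : S.black (opp (next h)) = !col := by rw [black_opp, e1]
      have e3 : (opp (next h)).1 = (next h).1 := rfl
      have e4 : prev (opp (next h)) = opp h := by rw [opp_prev, prev_next]
      simp only [G, e1, e2, e3, e4, prev_next, chainL_opp]
      cases col <;> simp <;> left <;> ring
    · have e : b.1 (next h) = 0 := hb _ (by
        rw [S.black_next]; revert hc; cases S.black h <;> cases col <;> simp)
      rw [e, mul_zero, mul_zero]
  have h2 : ∑ k, G k * b.1 k = 0 := S.sum_org_mul_eq_zero b.1 hbc F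
  have h3 : ∑ k, G (opp k) * b.1 k = 0 := by
    rw [← sum_opp, ← neg_zero, ← h2, ← Finset.sum_neg_distrib]
    exact Finset.sum_congr rfl fun k _ => by rw [opp_opp, chainL_opp]; ring
  simp only [crossing, h1]
  rw [sum_next (fun k => (G k - G (opp k)) * b.1 k)]
  simp only [sub_mul, Finset.sum_sub_distrib, h2, h3]
  norm_num

theorem crossing_eq_zero_of_onGamma {a a' : S.ChainL} (h : S.OnGamma a) (h' : S.OnGamma a') :
    S.crossing a a' = 0 := by
  rw [crossing, Finset.sum_eq_zero, mul_zero]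
  intro x _
  cases hx : S.black x
  · rw [h x hx, zero_mul]
  · rw [h' (next x) (by rw [S.black_next, hx]; rfl), mul_zero]

theorem crossing_eq_zero_of_onGammaStar {a a' : S.ChainL} (h : S.OnGammaStar a)
    (h' : S.OnGammaStar a') : S.crossing a a' = 0 := by
  rw [crossing, Finset.sum_eq_zero, mul_zero]
  intro x _
  cases hx : S.black x
  · rw [h' (next x) (by rw [S.black_next, hx]; rfl), mul_zero]
  · rw [h x hx, zero_mul]

theorem IsHomologous.toDiam_sub_mem {S : DiscreteRiemannSurface Q} {a a' : S.ChainL}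
    {c : S.ChainD} (h : S.IsHomologous a c) (h' : S.IsHomologous a' c) :
    S.toDiam (a - a') ∈ S.boundariesD := by
  have := S.boundariesD.sub_mem h.2 h'.2
  rwa [sub_sub_sub_cancel_right, ← toDiam_sub] at this

/-- One representative is changed at a time; the second change uses antisymmetry and the opposite
colour. -/
theorem crossing_congr {c c' : S.ChainD} {a a' b b' : S.ChainL} (ha : S.IsGammaPart c a)
    (ha' : S.IsGammaPart c a') (hb : S.IsGammaStarPart c' b) (hb' : S.IsGammaStarPart c' b') :
    S.crossing a b = S.crossing a' b' := by
  have h1 : S.crossing (a - a') b = 0 :=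
    S.crossing_eq_zero_of_mem_boundariesD true
      (fun h hh => by
        have e : S.black h = false := by simpa using hh
        simp [ha.1 h e, ha'.1 h e])
      hb.1 hb.2.1 (ha.2.toDiam_sub_mem ha'.2)
  have h2 : S.crossing (b - b') a' = 0 :=
    S.crossing_eq_zero_of_mem_boundariesD false
      (fun h hh => by
        have e : S.black h = true := by simpa using hh
        simp [hb.1 h e, hb'.1 h e])
      ha'.1 ha'.2.1 (hb.2.toDiam_sub_mem hb'.2)
  rw [crossing_sub_left] at h1 h2
  rw [S.crossing_swap a' b']
  have := S.crossing_swap a' b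
  linarith

theorem wedge_eta_eta {c c' : S.ChainL} (hc : S.IsCycleL c) (hc' : S.IsCycleL c') :
    S.wedge (S.eta c) (S.eta c') = (1 / 2) * S.crossing c c' := by
  have h := S.isEta_eta hc'
  rw [S.wedge_eta_left hc h.1.closed_and_coclosed.1, h.2 c hc]

/-- The intersection number of two cycles of `◇` counts the crossings of their representatives on
`Γ` and on `Γ*`, in either order. -/
theorem HasIntersection.crossing_eq {S : DiscreteRiemannSurface Q} {c c' : S.ChainD} {z : ℂ}
    (h : S.HasIntersection c c' z) {a b a' b' : S.ChainL} (ha : S.IsGammaPart c a)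
    (hb : S.IsGammaStarPart c b) (ha' : S.IsGammaPart c' a') (hb' : S.IsGammaStarPart c' b') :
    (S.crossing a b' : ℂ) = z ∧ (S.crossing b a' : ℂ) = z := by
  obtain ⟨ν, ν', ⟨hν, a1, b1, ha1, hb1, e1⟩, ⟨hν', a2, b2, ha2, hb2, e2⟩, rfl⟩ := h
  rw [S.wedgeD_eq_wedge_average hν hν', e1, e2]
  simp only [wedge_add_left, wedge_add_right, S.wedge_eta_eta ha1.2.1 ha2.2.1,
    S.wedge_eta_eta ha1.2.1 hb2.2.1, S.wedge_eta_eta hb1.2.1 ha2.2.1,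
    S.wedge_eta_eta hb1.2.1 hb2.2.1, S.crossing_eq_zero_of_onGamma ha1.1 ha2.1,
    S.crossing_eq_zero_of_onGammaStar hb1.1 hb2.1]
  -- The wedge product gives only the sum of the two mixed crossing numbers. Equal periods of
  -- `average ν` along `a2` and `b2` give their equality.
  have h := S.integral_average_congr ha2.2 hb2.2 hν
  simp only [e1, integral_add, (S.isEta_eta ha1.2.1).2 _ ha2.2.1, (S.isEta_eta ha1.2.1).2 _ hb2.2.1,
    (S.isEta_eta hb1.2.1).2 _ ha2.2.1, (S.isEta_eta hb1.2.1).2 _ hb2.2.1,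
    S.crossing_eq_zero_of_onGamma ha2.1 ha1.1, S.crossing_eq_zero_of_onGammaStar hb2.1 hb1.1] at h
  rw [S.crossing_congr ha ha1 hb' hb2, S.crossing_swap b a', S.crossing_congr ha' ha2 hb hb1,
    ← S.crossing_swap b1 a2]
  rw [S.crossing_swap a2 b1, S.crossing_swap b2 a1] at h
  push_cast at h ⊢
  constructor
  · linear_combination (1 / 2) * h
  · linear_combination -(1 / 2) * h

/-! ### The Gram matrix. -/

theorem IsHarmonic.neg {S : DiscreteRiemannSurface Q} {η : S.FormL} (h : S.IsHarmonic η) :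
    S.IsHarmonic (-η) := by
  obtain ⟨h1, h2⟩ := h.closed_and_coclosed
  refine S.isHarmonic_of_closed_of_coclosed (funext fun v => ?_) (funext fun v => ?_)
  · simpa [d1] using congrFun h1 v
  · simpa [d1_hodge_apply] using congrFun h2 v

theorem wedge_neg_left (α β : S.FormL) : S.wedge (-α) β = -S.wedge α β := by
  simp only [wedge_eq, Submodule.coe_neg, Pi.neg_apply, neg_mul, Finset.sum_neg_distrib, mul_neg]

/-- The scalar products of real forms with a dual family of chains form a real, symmetric and
positive definite matrix. -/
theorem exists_posDef_gram {ι : Type*} [Fintype ι] [DecidableEq ι] {c : ι → S.ChainL}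
    {α : ι → S.FormL} (hd : ∀ k l, S.integral (c k) (α l) = if k = l then 1 else 0)
    (hr : ∀ k, S.conjForm (α k) = α k) :
    ∃ R : Matrix ι ι ℝ, (∀ k l, S.scalar (α k) (α l) = (R k l : ℂ)) ∧ R.IsSymm ∧ R.PosDef := by
  classical
  -- The Gram matrix is `Bᵀ W B`, where the columns of `B` are the real forms and `W` carries the
  -- weights `¼ ρ` of `scalar_eq`.
  let B : Matrix (Side Q) ι ℝ := .of fun h k => ((α k).1 h).re
  have hB : ∀ k h, (α k).1 h = B h k := fun k h =>
    (Complex.conj_eq_iff_re.1 (congrFun (congrArg Subtype.val (hr k)) h)).symm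
  let W : Matrix (Side Q) (Side Q) ℝ := .diagonal fun h => (1 / 4) * S.rho h
  have hW : W.PosDef := Matrix.posDef_diagonal_iff.2 fun h => by have := S.rho_pos h; positivity
  -- Integrating a vanishing combination of the forms along `c k` isolates its `k`-th coefficient.
  have hinj : Function.Injective B.mulVec := by
    refine (injective_iff_map_eq_zero B.mulVecLin).2 fun x hx => funext fun k => ?_
    have h1 : ∑ l, (x l : ℂ) * S.integral (c k) (α l) = 0 := by
      have h2 : ∀ h, ∑ l, (x l : ℂ) * (α l).1 h = 0 := fun h => by
        have := congrFun hx h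
        simp only [Matrix.mulVecLin_apply, Matrix.mulVec, dotProduct, Pi.zero_apply] at this
        simp only [hB]
        rw [← Complex.ofReal_zero, ← this]; push_cast
        exact Finset.sum_congr rfl fun l _ => mul_comm _ _
      have h3 : ∀ l, (x l : ℂ) * S.integral (c k) (α l) =
          ∑ h, (1 / 2) * ((c k).1 h : ℂ) * ((x l : ℂ) * (α l).1 h) := fun l => by
        rw [integral, Finset.mul_sum, Finset.mul_sum]
        exact Finset.sum_congr rfl fun h _ => by ring
      simp only [h3]
      rw [Finset.sum_comm]
      simp only [← Finset.mul_sum, h2, mul_zero, Finset.sum_const_zero]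
    simpa [hd] using h1
  have hP := hW.conjTranspose_mul_mul_same hinj
  refine ⟨_, fun k l => ?_, ?_, hP⟩
  · rw [scalar_eq, Matrix.mul_apply, Finset.mul_sum]; push_cast
    refine Finset.sum_congr rfl fun h _ => ?_
    simp only [hB, Complex.conj_ofReal, W, Matrix.mul_diagonal, Matrix.conjTranspose_apply,
      star_trivial]
    push_cast; ring
  · have := hP.isHermitian
    rwa [Matrix.IsHermitian, Matrix.conjTranspose_eq_transpose_of_trivial] at this

end DiscreteRiemannSurface

end

/-! ### The proposition. -/

theorem mainTheorem5 {Q : Type*} [Fintype Q] (S : DiscreteRiemannSurface Q) (g : ℕ)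
    (D : S.CanonicalDissection g)
    (a b : Fin g ⊕ Fin g → S.ChainL)
    (ha : ∀ k, S.IsGammaPart (D.cyc k) (a k))
    (hb : ∀ k, S.IsGammaStarPart (D.cyc k) (b k))
    (aleph : DiscreteRiemannSurface.Index g → S.ChainL)
    (haleph : aleph = DiscreteRiemannSurface.alephL a b)
    (α : DiscreteRiemannSurface.Index g → S.FormL)
    (hα : α = DiscreteRiemannSurface.alpha aleph) :
    -- the `α k` are real harmonic forms, dual to the cycles `aleph`
    (∀ k, S.IsHarmonic (α k) ∧ S.conjForm (α k) = α k) ∧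
    (∀ k l, S.integral (aleph k) (α l) = if k = l then 1 else 0) ∧
    -- the matrix of inner products is real, symmetric and positive definite
    (∃ R : Matrix (DiscreteRiemannSurface.Index g) (DiscreteRiemannSurface.Index g) ℝ,
      (∀ k l, S.scalar (α k) (α l) = (R k l : ℂ)) ∧ R.IsSymm ∧ R.PosDef) ∧
    -- its entries as integrals of wedge products, and as periods
    (∀ k l, S.scalar (α k) (α l) = S.wedge (α k) (S.hodge (S.conjForm (α l)))) ∧
    (∀ j l, S.scalar (α (.inl j)) (α l) =
      (1 / 2) * S.integral (aleph (.inr j)) (S.hodge (α l))) ∧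
    (∀ j l, S.scalar (α (.inr j)) (α l) =
      -(1 / 2) * S.integral (aleph (.inl j)) (S.hodge (α l))) := by
  classical
  have hcyc : ∀ k, S.IsCycleL (aleph k) := by
    rintro ((k | k) | (k | k)) <;> subst haleph
    exacts [(ha _).2.1, (hb _).2.1, (hb _).2.1, (ha _).2.1]
  have hαl : ∀ j, α (.inl j) = S.eta (aleph (.inr j)) := fun j => by rw [hα]; rfl
  have hαr : ∀ j, α (.inr j) = -S.eta (aleph (.inl j)) := fun j => by rw [hα]; rfl
  have hharm : ∀ k, S.IsHarmonic (α k) ∧ S.conjForm (α k) = α k := by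
    rintro (j | j)
    · rw [hαl]
      exact ⟨(S.isEta_eta (hcyc _)).1, S.conjForm_eta (hcyc _)⟩
    · rw [hαr]
      refine ⟨?_, ?_⟩
      · exact (S.isEta_eta (hcyc _)).1.neg
      · have := S.conjForm_eta (hcyc (.inl j))
        rw [S.conjForm_neg, this]
  have hdual : ∀ k l, S.integral (aleph k) (α l) = if k = l then 1 else 0 := by
    have hl : ∀ k j, S.integral (aleph k) (α (.inl j)) = S.crossing (aleph k) (aleph (.inr j)) :=
      fun k j => by rw [hαl]; exact (S.isEta_eta (hcyc _)).2 _ (hcyc _)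
    -- Antisymmetry of crossings absorbs the minus sign in `α_{j + 2g} = -η_{ℵ_j}`.
    have hr : ∀ k j, S.integral (aleph k) (α (.inr j)) = S.crossing (aleph (.inl j)) (aleph k) :=
      fun k j => by
        rw [hαr, S.integral_neg, (S.isEta_eta (hcyc _)).2 _ (hcyc _), S.crossing_swap]
        push_cast; ring
    have haa := fun k l => S.crossing_eq_zero_of_onGamma (ha k).1 (ha l).1
    have hbb := fun k l => S.crossing_eq_zero_of_onGammaStar (hb k).1 (hb l).1
    have hll := fun k l => (D.inter_left k l).crossing_eq (ha _) (hb _) (ha _) (hb _)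
    have hrr := fun k l => (D.inter_right k l).crossing_eq (ha _) (hb _) (ha _) (hb _)
    have hlr := fun k l => (D.inter k l).crossing_eq (ha _) (hb _) (ha _) (hb _)
    intro k l
    -- Pairs of one colour cross zero times; mixed pairs reduce to the intersection numbers of the
    -- dissection. The arrangement of `ℵ^Λ` gives each `ℵ_j` and `ℵ_{j + 2g}` opposite colours.
    rcases l with l | l
    · rw [hl]
      rcases k with (k | k) | (k | k) <;> rcases l with l | l <;> subst haleph <;>
        simp [DiscreteRiemannSurface.alephL, haa, hbb, hlr, hrr]
    · rw [hr]
      rcases k with (k | k) | (k | k) <;> rcases l with l | l <;> subst haleph <;>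
        simp [DiscreteRiemannSurface.alephL, haa, hbb, hlr, hll, eq_comm]
  have hwedge := fun k l => S.wedge_hodge_conjForm (α k) (α l)
  have hco := fun l => (hharm l).1.closed_and_coclosed.2
  refine ⟨hharm, hdual, ?_, hwedge, fun j l => ?_, fun j l => ?_⟩
  · exact S.exists_posDef_gram hdual fun k => (hharm k).2
  · rw [hwedge, (hharm l).2, hαl, S.wedge_eta_left (hcyc _) (hco l)]
  · rw [hwedge, (hharm l).2, hαr, S.wedge_neg_left, S.wedge_eta_left (hcyc _) (hco l), neg_mul]
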